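/- Let $W\in\{0,1\}$ be a binary treatment, $Y(1),Y(0)$ real-valued potential outcomes, $Y=W\,Y(1)+(1-W)\,Y(0)$, and $X$ a continuously distributed covariate with values in $\mathcal X=[x_L,x_U]\subset\mathbb R$, $x_L<x_U$. Suppose that the propensity score $p(x)=\mathbb E[W\mid X=x]$ (in a suitable version) is monotone increasing and continuously differentiable on $\mathcal X$ with $p'(x)>0$ for all $x\in\mathcal X$; that $X$ has a continuous density $f$ on $\mathcal X$ with $\underline f<f(x)<\overline f$ for all $x\in\mathcal X$ and some constants $\underline f,\overline f>0$; and that there are constants $\underline p,\overline p$ with $0<\underline p\le p(x)\le\overline p<1$ for all $x\in\mathcal X$. For each $N$ let $(Y_i,W_i,X_i)_{i=1}^N$ be an iid sample of $(Y,W,X)$, indexed so that $X_1<\dots<X_N$ (there are almost surely no ties). Put $m=\lfloor N^{2/3}\rfloor$ and $$\tilde W_i=\begin{cases}\frac1m\sum_{j=1}^{m}W_j & i\le m,\\ W_i & m<i\le N-m,\\ \frac1m\sum_{j=N-m+1}^{N}W_j & i>N-m\end{cases}$$ (if cases overlap, which happens only for small $N$, the first applies). The UC-isotonic estimator is $$\tilde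 p(X_i)=\max_{s\le i}\min_{t\ge i}\frac1{t-s+1}\sum_{j=s}^{t}\tilde W_j ,$$ extended by $\tilde p(x)=\tilde p(X_i)$ for $X_{i-1}<x\le X_i$ (with $X_0=-\infty$) and $\tilde p(x)=\tilde p(X_N)$ for $x>X_N$. Let $$\mathcal J(i)=\{j\in\{1,\dots,N\}: W_j=1-W_i,\ \tilde p(X_j)=\tilde p(X_i)\}.$$ Then $$\lim_{N\to\infty}\mathbb P\bigl(\mathcal J(i)\neq\emptyset\ \text{ for all } i=1,\dots,N\bigr)=1 .$$ -/

import Mathlib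

open MeasureTheory ProbabilityTheory Filter Topology

noncomputable section

namespace UCIso

/-! ### The estimator, as a function of data `(w i, x i)`, `i : Fin N`, ordered by `x`

Indices are zero-based: the `i`-th observation in the usual one-based numbering has index `i - 1`. -/

/-- The number `⌊N ^ (2/3)⌋` of observations that are averaged at either end of the sample. -/
def blockSize (N : ℕ) : ℕ := ⌊(N : ℝ) ^ (2 / 3 : ℝ)⌋₊

/-- The transformed treatments: the first and the last `⌊N ^ (2/3)⌋` entries of `w` are replaced
by their averages. (If the two blocks overlap, which can happen only for small `N`, the first case
takes precedence.) -/
def transformed {N : ℕ} (w : Fin N → ℝ) (i : Fin N) : ℝ :=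
  if i.val < blockSize N then
    (∑ j : Fin N with j.val < blockSize N, w j) / blockSize N
  else if i.val < N - blockSize N then
    w i
  else
    (∑ j : Fin N with N - blockSize N ≤ j.val, w j) / blockSize N

/-- The isotonic regression of `v` at the `i`-th design point, by the max-min formula
`max_{s ≤ i} min_{t ≥ i} (∑_{j = s}^t v j) / (t - s + 1)`. -/
def maxMin {N : ℕ} (v : Fin N → ℝ) (i : Fin N) : ℝ :=
  (Finset.Iic i).sup' Finset.nonempty_Iic fun s =>
    (Finset.Ici i).inf' Finset.nonempty_Ici fun t =>
      (∑ j ∈ Finset.Icc s t, v j) / ((t.val : ℝ) - (s.val : ℝ) + 1)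

/-- The UC-isotonic estimator as a function on the line: at `u` its value is the fitted value at the
first design point `x i ≥ u`, and the fitted value at the last design point if `u` exceeds all of
them. (For an empty sample it is `0`.) -/
def ucIsotonic {N : ℕ} (w x : Fin N → ℝ) (u : ℝ) : ℝ :=
  if h : (Finset.univ.filter fun i : Fin N => u ≤ x i).Nonempty then
    maxMin (transformed w) ((Finset.univ.filter fun i : Fin N => u ≤ x i).min' h)
  else if h' : (Finset.univ : Finset (Fin N)).Nonempty then
    maxMin (transformed w) ((Finset.univ : Finset (Fin N)).max' h')
  else 0

/-- The matching counterparts of observation `i`: the observations with the opposite treatment and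
the same value of the UC-isotonic estimator. -/
def matchedSet {N : ℕ} (w x : Fin N → ℝ) (i : Fin N) : Set (Fin N) :=
  {j | w j = 1 - w i ∧ ucIsotonic w x (x j) = ucIsotonic w x (x i)}

/-- The data `a` re-indexed by increasing values of `x`. -/
def ordered {N : ℕ} (x a : Fin N → ℝ) : Fin N → ℝ := a ∘ Tuple.sort x

/-! ### The assumptions -/

section Assumptions

variable {Ω₀ : Type*} [MeasurableSpace Ω₀]

/-- The population: potential outcomes `Y1`, `Y0`, a binary treatment `W`, and a continuously
distributed scalar covariate `X` with values in `[xL, xU]`. -/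
structure IsPopulation (P₀ : Measure Ω₀) (Y1 Y0 W X : Ω₀ → ℝ) (xL xU : ℝ) : Prop where
  measurable_Y1 : Measurable Y1
  measurable_Y0 : Measurable Y0
  measurable_W : Measurable W
  measurable_X : Measurable X
  binary : ∀ᵐ ω ∂P₀, W ω = 0 ∨ W ω = 1
  mem_Icc : ∀ᵐ ω ∂P₀, X ω ∈ Set.Icc xL xU
  continuous_law : ∀ x, P₀ {ω | X ω = x} = 0

/-- The observed outcome `Y = W Y(1) + (1 - W) Y(0)`. -/
def outcome (Y1 Y0 W : Ω₀ → ℝ) (ω : Ω₀) : ℝ := W ω * Y1 ω + (1 - W ω) * Y0 ω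

/-- `(Y i, W i, X i)`, `i : Fin N`, is an iid sample, not yet ordered, of the population triple
`(Y, W, X)`. -/
structure IsIIDSample {Ω : Type*} [MeasurableSpace Ω] (P : Measure Ω) {N : ℕ}
    (Ys Ws Xs : Fin N → Ω → ℝ) (P₀ : Measure Ω₀) (Y W X : Ω₀ → ℝ) : Prop where
  indep : iIndepFun (fun i ω => (Ys i ω, Ws i ω, Xs i ω)) P
  identDistrib : ∀ i, IdentDistrib (fun ω => (Ys i ω, Ws i ω, Xs i ω))
    (fun ω => (Y ω, W ω, X ω)) P P₀

/-- `p` is a version of the propensity score `x ↦ E[W | X = x]`. -/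
def IsPropensityScore (P₀ : Measure Ω₀) (W X : Ω₀ → ℝ) (p : ℝ → ℝ) : Prop :=
  P₀[W | MeasurableSpace.comap X inferInstance] =ᵐ[P₀] fun ω => p (X ω)

/-- Monotonicity and smoothness of `p` on `[xL, xU]`, and a continuous density of `X` there that is
bounded and bounded away from zero. -/
structure MonotoneSmooth (P₀ : Measure Ω₀) (X : Ω₀ → ℝ) (p : ℝ → ℝ) (xL xU : ℝ) : Prop where
  monotone : MonotoneOn p (Set.Icc xL xU)
  contDiff : ContDiffOn ℝ 1 p (Set.Icc xL xU)
  deriv_pos : ∀ x ∈ Set.Icc xL xU, 0 < derivWithin p (Set.Icc xL xU) x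
  density : ∃ f : ℝ → ℝ, ContinuousOn f (Set.Icc xL xU) ∧
    (∃ fLow fUp : ℝ, 0 < fLow ∧ 0 < fUp ∧ ∀ x ∈ Set.Icc xL xU, fLow < f x ∧ f x < fUp) ∧
    P₀.map X = (volume.restrict (Set.Icc xL xU)).withDensity fun x => ENNReal.ofReal (f x)

end Assumptions

/-- Strict overlap on `[xL, xU]`. -/
def StrictOverlap (p : ℝ → ℝ) (xL xU : ℝ) : Prop :=
  ∃ pLow pUp : ℝ, 0 < pLow ∧ pUp < 1 ∧ ∀ x ∈ Set.Icc xL xU, pLow ≤ p x ∧ p x ≤ pUp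

end UCIso

end

/-! Once each end block contains both treatments, matching is deterministic (`matchedSet_nonempty`).
A level set of the fit that meets an end block contains all of it, because the fit is constant on
runs of constant data (`maxMin_eq_of_const`). Any other level set lies in the middle, where the data
are the raw 0/1 treatments. Its first entry is at least the fitted value and its last entry at most
that value. Averaging the end blocks puts the fit strictly between 0 and 1 (`maxMin_pos`,
`maxMin_lt_one`), so the first unit is treated and the last is not.

The end blocks contain both treatments with probability tending to one. Within `N ^ (-2/3)` of an
endpoint of the support the expected number of observations is of order `N ^ (1/3)`. This is small
against the block size, so by Markov these observations fit in the block (`measureReal_lt_card_le`).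
It still diverges, so by overlap and independence both treatments occur among them
(`measureReal_forall_not_le`). -/

namespace UCIso

/-! ### Level sets of the max-min formula. -/

section MaxMin

variable {N : ℕ}

lemma sum_Icc_sub_const (v : Fin N → ℝ) (c : ℝ) {s t : Fin N} (h : s ≤ t) :
    ∑ j ∈ Finset.Icc s t, (v j - c)
      = ∑ j ∈ Finset.Icc s t, v j - c * ((t.val : ℝ) - (s.val : ℝ) + 1) := by
  have h' : s.val ≤ t.val := h
  rw [Finset.sum_sub_distrib, Finset.sum_const, Fin.card_Icc, nsmul_eq_mul,
    Nat.cast_sub (by omega)]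
  push_cast
  ring

lemma sub_add_one_pos {s t : Fin N} (h : s ≤ t) : 0 < (t.val : ℝ) - (s.val : ℝ) + 1 := by
  have h' : (s.val : ℝ) ≤ t.val := by exact_mod_cast h
  linarith

/-- Clearing the positive denominators turns bounds on the fit into signs of sums of `v - c`, which
are additive over adjacent intervals. -/
lemma le_maxMin_iff (v : Fin N → ℝ) (i : Fin N) (c : ℝ) :
    c ≤ maxMin v i ↔ ∃ s ≤ i, ∀ t ≥ i, 0 ≤ ∑ j ∈ Finset.Icc s t, (v j - c) := by
  simp only [maxMin, Finset.le_sup'_iff, Finset.le_inf'_iff, Finset.mem_Iic, Finset.mem_Ici]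
  refine exists_congr fun s => and_congr_right fun hs => forall₂_congr fun t ht => ?_
  rw [sum_Icc_sub_const v c (hs.trans ht), le_div_iff₀ (sub_add_one_pos (hs.trans ht)), sub_nonneg]

lemma lt_maxMin_iff (v : Fin N → ℝ) (i : Fin N) (c : ℝ) :
    c < maxMin v i ↔ ∃ s ≤ i, ∀ t ≥ i, 0 < ∑ j ∈ Finset.Icc s t, (v j - c) := by
  simp only [maxMin, Finset.lt_sup'_iff, Finset.lt_inf'_iff, Finset.mem_Iic, Finset.mem_Ici]
  refine exists_congr fun s => and_congr_right fun hs => forall₂_congr fun t ht => ?_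
  rw [sum_Icc_sub_const v c (hs.trans ht), lt_div_iff₀ (sub_add_one_pos (hs.trans ht)), sub_pos]

lemma maxMin_mono (v : Fin N → ℝ) : Monotone (maxMin v) := by
  intro i j hij
  obtain ⟨s, hs, h⟩ := (le_maxMin_iff v i _).1 le_rfl
  exact (le_maxMin_iff v j _).2 ⟨s, hs.trans hij, fun t ht => h t (hij.trans ht)⟩

lemma sum_Icc_eq_add (u : Fin N → ℝ) {s k l t : Fin N} (hsk : s ≤ k) (hkl : k.val + 1 = l.val)
    (hlt : l ≤ t) :
    ∑ j ∈ Finset.Icc s t, u j = ∑ j ∈ Finset.Icc s k, u j + ∑ j ∈ Finset.Icc l t, u j := by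
  rw [← Finset.sum_union]
  · congr 1
    ext j
    simp only [Finset.mem_union, Finset.mem_Icc, Fin.le_def] at *
    omega
  · rw [Finset.disjoint_left]
    intro j
    simp only [Finset.mem_Icc, Fin.le_def]
    omega

/-- At the first index of a level set the data lie above the fit. -/
lemma maxMin_le_of_forall_lt (v : Fin N → ℝ) (a : Fin N) (ha : ∀ j < a, maxMin v j < maxMin v a) :
    maxMin v a ≤ v a := by
  by_contra! hlt
  obtain ⟨s, hs, h⟩ := (le_maxMin_iff v a _).1 le_rfl
  have haa := h a le_rfl
  rcases hs.eq_or_lt with rfl | hsa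
  · simp only [Finset.Icc_self, Finset.sum_singleton] at haa
    linarith
  · have hsa' : s.val < a.val := hsa
    let k : Fin N := ⟨a.val - 1, by omega⟩
    have hk : k.val + 1 = a.val := by simp only [k]; omega
    have hsk : s ≤ k := by simp only [Fin.le_def, k]; omega
    rw [sum_Icc_eq_add _ hsk hk le_rfl, Finset.Icc_self, Finset.sum_singleton] at haa
    have hka : k < a := by simp only [Fin.lt_def]; omega
    -- The same `s` witnesses the level of `a` at `k = a - 1`: the only new endpoint is `t = k`, and
    -- dropping the negative term at `a` raises the sum.
    refine (ha k hka).not_ge ((le_maxMin_iff v k _).2 ⟨s, hsk, fun t ht => ?_⟩)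
    rcases ht.lt_or_eq with hlt' | rfl
    · exact h t (by simp only [Fin.le_def, Fin.lt_def] at *; omega)
    · linarith

/-- At the last index of a level set the data lie below the fit. -/
lemma le_maxMin_of_forall_gt (v : Fin N → ℝ) (b : Fin N) (hb : ∀ j > b, maxMin v b < maxMin v j) :
    v b ≤ maxMin v b := by
  by_contra! hlt
  have key : ∀ s ≤ b, ∃ t ≥ b, ∑ j ∈ Finset.Icc s t, (v j - maxMin v b) ≤ 0 := by
    by_contra! h
    exact lt_irrefl _ ((lt_maxMin_iff v b _).2 h)
  obtain ⟨t, ht, hbt⟩ := key b le_rfl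
  rcases ht.lt_or_eq with hlt' | rfl
  · have hbt' : b.val < t.val := hlt'
    let l : Fin N := ⟨b.val + 1, by omega⟩
    have hl : b.val + 1 = l.val := rfl
    have hlt'' : l ≤ t := by simp only [Fin.le_def, l]; omega
    rw [sum_Icc_eq_add _ le_rfl hl hlt'', Finset.Icc_self, Finset.sum_singleton] at hbt
    have hbl : b < l := by simp only [Fin.lt_def, l]; omega
    -- The sum over `Icc l t` is negative since `v b` exceeds the fit, so `s ≠ l`. For `s ≤ b`,
    -- `key` can only stop at `t' = b`; appending `Icc l t` then contradicts positivity.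
    obtain ⟨s, hs, h⟩ := (lt_maxMin_iff v l _).1 (hb l hbl)
    rcases hs.eq_or_lt with rfl | hsl
    · linarith [h t hlt'']
    · have hsb : s ≤ b := by simp only [Fin.le_def, Fin.lt_def] at *; omega
      obtain ⟨t', ht', hst'⟩ := key s hsb
      rcases ht'.lt_or_eq with hlt₃ | rfl
      · exact absurd (h t' (by simp only [Fin.le_def, Fin.lt_def] at *; omega)) hst'.not_gt
      · have := h t hlt''
        rw [sum_Icc_eq_add _ hsb hl hlt''] at this
        linarith
  · rw [Finset.Icc_self, Finset.sum_singleton] at hbt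
    linarith

/-- A jump would end one level set at `k` and start another at `l`, forcing `v k ≤ maxMin v k <
maxMin v l ≤ v l`. -/
lemma maxMin_eq_of_eq_succ (v : Fin N → ℝ) {k l : Fin N} (hkl : k.val + 1 = l.val)
    (hv : v k = v l) : maxMin v k = maxMin v l := by
  have hle : k ≤ l := by simp only [Fin.le_def]; omega
  refine (maxMin_mono v hle).eq_or_lt.resolve_right fun hlt => ?_
  have h₁ := le_maxMin_of_forall_gt v k fun j hj =>
    hlt.trans_le (maxMin_mono v (by simp only [Fin.le_def, Fin.lt_def, gt_iff_lt] at *; omega))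
  have h₂ := maxMin_le_of_forall_lt v l fun j hj =>
    (maxMin_mono v (by simp only [Fin.le_def, Fin.lt_def] at *; omega : j ≤ k)).trans_lt hlt
  linarith

/-- The fit is constant on runs on which the data are constant. -/
lemma maxMin_eq_of_const (v : Fin N → ℝ) {k l : Fin N} (hkl : k ≤ l)
    (hv : ∀ j, k ≤ j → j ≤ l → v j = v k) : maxMin v k = maxMin v l := by
  obtain ⟨d, hd⟩ : ∃ d, l.val = k.val + d := ⟨l.val - k.val, by rw [Fin.le_def] at hkl; omega⟩
  induction d generalizing l with
  | zero => rw [show l = k from Fin.ext (by simpa using hd)]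
  | succ d ih =>
    let l' : Fin N := ⟨k.val + d, by omega⟩
    have hkl' : k ≤ l' := by simp only [Fin.le_def, l']; omega
    have hl'l : l' ≤ l := by simp only [Fin.le_def, l']; omega
    rw [ih hkl' (fun j h₁ h₂ => hv j h₁ (h₂.trans hl'l)) rfl]
    exact maxMin_eq_of_eq_succ v (by simp only [l']; omega)
      ((hv l' hkl' hl'l).trans (hv l hkl le_rfl).symm)

/-- Starting at the first index puts a positive entry in every average. -/
lemma maxMin_pos (v : Fin N → ℝ) (hv : ∀ j, 0 ≤ v j) (hv₀ : ∀ j : Fin N, j.val = 0 → 0 < v j)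
    (i : Fin N) : 0 < maxMin v i := by
  refine (lt_maxMin_iff v i 0).2 ⟨⟨0, i.pos⟩, Nat.zero_le _, fun t _ => ?_⟩
  exact Finset.sum_pos' (fun j _ => by simpa using hv j)
    ⟨⟨0, i.pos⟩, Finset.mem_Icc.2 ⟨le_rfl, Nat.zero_le _⟩, by simpa using hv₀ ⟨0, i.pos⟩ rfl⟩

/-- Ending at the last index puts an entry below one in every average. -/
lemma maxMin_lt_one (v : Fin N → ℝ) (hv : ∀ j, v j ≤ 1)
    (hv₁ : ∀ j : Fin N, j.val + 1 = N → v j < 1) (i : Fin N) : maxMin v i < 1 := by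
  by_contra! h
  obtain ⟨s, hs, h⟩ := (le_maxMin_iff v i 1).1 h
  have hi := i.pos
  let t : Fin N := ⟨N - 1, by omega⟩
  have ht : ∀ j : Fin N, j ≤ t := fun j => by simp only [Fin.le_def, t]; omega
  have hneg : ∑ j ∈ Finset.Icc s t, (v j - 1) < 0 :=
    Finset.sum_neg' (fun j _ => by linarith [hv j])
      ⟨t, Finset.mem_Icc.2 ⟨ht s, le_rfl⟩, by linarith [hv₁ t (by simp only [t]; omega)]⟩
  exact (h t (ht i)).not_gt hneg

end MaxMin

/-! ### Deterministic matching. -/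

section Matching

variable {N : ℕ}

lemma ucIsotonic_apply (w : Fin N → ℝ) {x : Fin N → ℝ} (hx : StrictMono x) (i : Fin N) :
    ucIsotonic w x (x i) = maxMin (transformed w) i := by
  have h : (Finset.univ.filter fun k : Fin N => x i ≤ x k).Nonempty := ⟨i, by simp⟩
  rw [ucIsotonic, dif_pos h]
  congr 1
  exact le_antisymm (Finset.min'_le _ _ (by simp))
    (Finset.le_min' _ _ _ fun k hk => hx.le_iff_le.1 (by simpa using hk))

lemma avg_mem_Ioo {s : Finset (Fin N)} {w : Fin N → ℝ} (hw : ∀ i, w i = 0 ∨ w i = 1) {m : ℕ}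
    (hm : s.card = m) (h₀ : ∃ i ∈ s, w i = 0) (h₁ : ∃ i ∈ s, w i = 1) :
    (∑ j ∈ s, w j) / m ∈ Set.Ioo (0 : ℝ) 1 := by
  obtain ⟨a, ha, ha0⟩ := h₀
  obtain ⟨b, hb, hb1⟩ := h₁
  have hpos : (0 : ℝ) < m := by
    rw [← hm]
    exact_mod_cast Finset.card_pos.2 ⟨a, ha⟩
  constructor
  · refine div_pos (Finset.sum_pos' (fun j _ => ?_) ⟨b, hb, by simp [hb1]⟩) hpos
    rcases hw j with h | h <;> simp [h]
  · rw [div_lt_one hpos, ← hm]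
    calc ∑ j ∈ s, w j < ∑ _j ∈ s, (1 : ℝ) :=
          Finset.sum_lt_sum (fun j _ => by rcases hw j with h | h <;> simp [h])
            ⟨a, ha, by simp [ha0]⟩
      _ = s.card := by simp

/-- If either end block contains both treatments, every unit has a matching counterpart. -/
theorem matchedSet_nonempty {w x : Fin N → ℝ} (hw : ∀ i, w i = 0 ∨ w i = 1) (hx : StrictMono x)
    (hm : 2 * blockSize N ≤ N)
    (hfirst : ∀ c : ℝ, c = 0 ∨ c = 1 → ∃ i : Fin N, i.val < blockSize N ∧ w i = c)
    (hlast : ∀ c : ℝ, c = 0 ∨ c = 1 → ∃ i : Fin N, N - blockSize N ≤ i.val ∧ w i = c)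
    (i : Fin N) : (matchedSet w x i).Nonempty := by
  set m := blockSize N
  set v := transformed w with hv
  have hcompl : ∀ k : Fin N, 1 - w k = 0 ∨ 1 - w k = 1 := fun k => by
    rcases hw k with h | h <;> simp [h]
  obtain ⟨α, hα, hvα⟩ : ∃ α ∈ Set.Ioo (0 : ℝ) 1, ∀ j : Fin N, j.val < m → v j = α := by
    refine ⟨_, avg_mem_Ioo (s := Finset.univ.filter fun j : Fin N => j.val < m) hw (m := m) ?_
      ?_ ?_, fun j hj => by rw [hv, transformed, if_pos hj]⟩
    · rw [Fin.card_filter_val_lt, min_eq_right (by omega)]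
    · obtain ⟨a, ha⟩ := hfirst 0 (.inl rfl); exact ⟨a, by simpa using ha.1, ha.2⟩
    · obtain ⟨a, ha⟩ := hfirst 1 (.inr rfl); exact ⟨a, by simpa using ha.1, ha.2⟩
  obtain ⟨β, hβ, hvβ⟩ : ∃ β ∈ Set.Ioo (0 : ℝ) 1, ∀ j : Fin N, N - m ≤ j.val → v j = β := by
    refine ⟨_, avg_mem_Ioo (s := Finset.univ.filter fun j : Fin N => N - m ≤ j.val) hw (m := m) ?_
      ?_ ?_, fun j hj => by rw [hv, transformed, if_neg (by omega), if_neg (by omega)]⟩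
    · have hN := Finset.card_filter_add_card_filter_not (s := Finset.univ)
        (fun j : Fin N => j.val < N - m)
      simp only [not_lt, Fin.card_filter_val_lt, Finset.card_univ, Fintype.card_fin] at hN
      omega
    · obtain ⟨a, ha⟩ := hlast 0 (.inl rfl); exact ⟨a, by simpa using ha.1, ha.2⟩
    · obtain ⟨a, ha⟩ := hlast 1 (.inr rfl); exact ⟨a, by simpa using ha.1, ha.2⟩
  have hvmid : ∀ j : Fin N, m ≤ j.val → j.val < N - m → v j = w j := fun j h₁ h₂ => by
    rw [hv, transformed, if_neg (by omega), if_pos h₂]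
  have hm0 : 0 < m := by obtain ⟨a, ha, -⟩ := hfirst 0 (.inl rfl); omega
  have hv01 : ∀ j, 0 ≤ v j ∧ v j ≤ 1 := fun j => by
    by_cases h₁ : j.val < m
    · rw [hvα j h₁]; exact ⟨hα.1.le, hα.2.le⟩
    by_cases h₂ : j.val < N - m
    · rw [hvmid j (by omega) h₂]
      rcases hw j with h | h <;> simp [h]
    · rw [hvβ j (by omega)]; exact ⟨hβ.1.le, hβ.2.le⟩
  have hpos := maxMin_pos v (fun j => (hv01 j).1)
    (fun j hj => by rw [hvα j (by omega)]; exact hα.1) i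
  have hlt := maxMin_lt_one v (fun j => (hv01 j).2)
    (fun j hj => by rw [hvβ j (by omega)]; exact hβ.2) i
  -- `Q` is an order-convex set of indices; it will be each end block in turn.
  have hconst : ∀ (Q : Fin N → Prop) (γ : ℝ), (∀ j k l, Q j → Q k → j ≤ l → l ≤ k → Q l) →
      (∀ j, Q j → v j = γ) → ∀ j k, Q j → Q k → maxMin v j = maxMin v k := by
    intro Q γ hQ hγ j k hj hk
    rcases le_total j k with h | h
    · exact maxMin_eq_of_const v h fun l h₁ h₂ => by rw [hγ l (hQ j k l hj hk h₁ h₂), hγ j hj]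
    · exact (maxMin_eq_of_const v h fun l h₁ h₂ => by
        rw [hγ l (hQ k j l hk hj h₁ h₂), hγ k hk]).symm
  suffices ∃ j, w j = 1 - w i ∧ maxMin v j = maxMin v i by
    obtain ⟨j, hj, hj'⟩ := this
    exact ⟨j, hj, by rwa [ucIsotonic_apply w hx, ucIsotonic_apply w hx]⟩
  by_cases hB₁ : ∃ k : Fin N, k.val < m ∧ maxMin v k = maxMin v i
  · obtain ⟨k, hk, hki⟩ := hB₁
    obtain ⟨j, hj, hj'⟩ := hfirst _ (hcompl i)
    refine ⟨j, hj', (hconst (fun l => l.val < m) α ?_ hvα j k hj hk).trans hki⟩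
    intro j k l _ hk _ hlk
    exact lt_of_le_of_lt hlk hk
  by_cases hB₂ : ∃ k : Fin N, N - m ≤ k.val ∧ maxMin v k = maxMin v i
  · obtain ⟨k, hk, hki⟩ := hB₂
    obtain ⟨j, hj, hj'⟩ := hlast _ (hcompl i)
    refine ⟨j, hj', (hconst (fun l => N - m ≤ l.val) β ?_ hvβ j k hj hk).trans hki⟩
    intro j k l hj _ hjl _
    exact le_trans hj hjl
  push Not at hB₁ hB₂
  -- The level set of `i` now avoids both end blocks, so `v = w` on it.
  let B := Finset.univ.filter fun j => maxMin v j = maxMin v i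
  have hB : B.Nonempty := ⟨i, by simp [B]⟩
  have hmem : ∀ j ∈ B, maxMin v j = maxMin v i ∧ v j = w j := fun j hj => by
    have hj' : maxMin v j = maxMin v i := by simpa [B] using hj
    exact ⟨hj', hvmid j (not_lt.1 fun h => hB₁ j h hj') (not_le.1 fun h => hB₂ j h hj')⟩
  obtain ⟨ha, hva⟩ := hmem _ (B.min'_mem hB)
  obtain ⟨hb, hvb⟩ := hmem _ (B.max'_mem hB)
  have hfst := maxMin_le_of_forall_lt v (B.min' hB) fun j hj => by
    refine (maxMin_mono v hj.le).lt_of_ne fun h => hj.not_ge (B.min'_le j ?_)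
    simp [B, h, ha]
  have hlst := le_maxMin_of_forall_gt v (B.max' hB) fun j hj => by
    refine (maxMin_mono v (le_of_lt hj)).lt_of_ne fun h => not_lt.2 (B.le_max' j ?_) hj
    simp [B, ← h, hb]
  rw [ha, hva] at hfst
  rw [hb, hvb] at hlst
  -- The fitted value lies strictly between 0 and 1, so a binary entry on either side of it is
  -- determined.
  have hwa : w (B.min' hB) = 1 := (hw _).resolve_left fun h => by linarith
  have hwb : w (B.max' hB) = 0 := (hw _).resolve_right fun h => by linarith
  rcases hw i with h | h
  · exact ⟨_, by rw [hwa, h]; norm_num, ha⟩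
  · exact ⟨_, by rw [hwb, h]; norm_num, hb⟩

end Matching

/-! ### From covariate cutoffs to ranks. -/

section Ordering

variable {N : ℕ}

lemma strictMono_ordered {x : Fin N → ℝ} (hx : Function.Injective x) : StrictMono (ordered x x) :=
  (Tuple.monotone_sort x).strictMono_of_injective (hx.comp (Tuple.sort x).injective)

/-- All observations ranked no later than one below `a` are themselves below `a`, so its zero-based
rank is less than their number. -/
lemma exists_ordered_val_lt {x w : Fin N → ℝ} {a c : ℝ} {m : ℕ}
    (hcount : (Finset.univ.filter fun i => x i ∈ Set.Iic a).card ≤ m)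
    (h : ∃ i, x i ∈ Set.Iic a ∧ w i = c) : ∃ i : Fin N, i.val < m ∧ ordered x w i = c := by
  obtain ⟨i, hi, hwi⟩ := h
  refine ⟨(Tuple.sort x).symm i, ?_, by simp [ordered, hwi]⟩
  have hcard : (Finset.Iic ((Tuple.sort x).symm i)).card
      ≤ (Finset.univ.filter fun i => x i ∈ Set.Iic a).card := by
    refine Finset.card_le_card_of_injOn (Tuple.sort x) (fun k hk => ?_)
      (Tuple.sort x).injective.injOn
    have := Tuple.monotone_sort x (Finset.mem_Iic.1 (Finset.mem_coe.1 hk))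
    simp only [Function.comp_apply, Equiv.apply_symm_apply] at this
    simpa using this.trans hi
  rw [Fin.card_Iic] at hcard
  omega

lemma exists_ordered_le_val {x w : Fin N → ℝ} {b c : ℝ} {m : ℕ}
    (hcount : (Finset.univ.filter fun i => x i ∈ Set.Ici b).card ≤ m)
    (h : ∃ i, x i ∈ Set.Ici b ∧ w i = c) : ∃ i : Fin N, N - m ≤ i.val ∧ ordered x w i = c := by
  obtain ⟨i, hi, hwi⟩ := h
  refine ⟨(Tuple.sort x).symm i, ?_, by simp [ordered, hwi]⟩
  have hcard : (Finset.Ici ((Tuple.sort x).symm i)).card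
      ≤ (Finset.univ.filter fun i => x i ∈ Set.Ici b).card := by
    refine Finset.card_le_card_of_injOn (Tuple.sort x) (fun k hk => ?_)
      (Tuple.sort x).injective.injOn
    have := Tuple.monotone_sort x (Finset.mem_Ici.1 (Finset.mem_coe.1 hk))
    simp only [Function.comp_apply, Equiv.apply_symm_apply] at this
    simpa using le_trans hi this
  rw [Fin.card_Ici] at hcard
  omega

end Ordering

/-! ### Bounds on population masses. -/

section Population

variable {Ω₀ : Type*} [MeasurableSpace Ω₀] {P₀ : Measure Ω₀}
  {Y1 Y0 W X : Ω₀ → ℝ} {xL xU : ℝ} {p : ℝ → ℝ}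

lemma IsPopulation.integrable_W [IsFiniteMeasure P₀]
    (hpop : IsPopulation P₀ Y1 Y0 W X xL xU) : Integrable W P₀ := by
  refine Integrable.of_bound hpop.measurable_W.aestronglyMeasurable 1 ?_
  filter_upwards [hpop.binary] with ω h
  rcases h with h | h <;> simp [h]

lemma IsPopulation.setIntegral_W (hpop : IsPopulation P₀ Y1 Y0 W X xL xU) (A : Set ℝ) :
    ∫ ω in X ⁻¹' A, W ω ∂P₀ = P₀.real {ω | X ω ∈ A ∧ W ω = 1} := by
  have h1 : MeasurableSet {ω | W ω = 1} := hpop.measurable_W (measurableSet_singleton 1)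
  have hW : W =ᵐ[P₀] {ω | W ω = 1}.indicator 1 := by
    filter_upwards [hpop.binary] with ω h
    rcases h with h | h <;> simp [Set.indicator, h]
  rw [integral_congr_ae (ae_restrict_of_ae hW), integral_indicator_one h1,
    measureReal_restrict_apply h1, Set.inter_comm]
  rfl

/-- Under strict overlap either treatment has, uniformly over sets of covariate values, conditional
probability bounded below. -/
lemma exists_overlap_bound [IsFiniteMeasure P₀]
    (hpop : IsPopulation P₀ Y1 Y0 W X xL xU)
    (hp : IsPropensityScore P₀ W X p) (hoverlap : StrictOverlap p xL xU) :
    ∃ δ : ℝ, 0 < δ ∧ ∀ c : ℝ, c = 0 ∨ c = 1 → ∀ A : Set ℝ, MeasurableSet A →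
      δ * P₀.real (X ⁻¹' A) ≤ P₀.real {ω | X ω ∈ A ∧ W ω = c} := by
  obtain ⟨pLow, pUp, hLow, hUp, hpb⟩ := hoverlap
  have hb : ∀ᵐ ω ∂P₀, pLow ≤ (P₀[W | MeasurableSpace.comap X inferInstance]) ω ∧
      (P₀[W | MeasurableSpace.comap X inferInstance]) ω ≤ pUp := by
    filter_upwards [hp, hpop.mem_Icc] with ω h₁ h₂
    rw [h₁]
    exact hpb _ h₂
  have hone : ∀ A : Set ℝ, MeasurableSet A →
      pLow * P₀.real (X ⁻¹' A) ≤ P₀.real {ω | X ω ∈ A ∧ W ω = 1} ∧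
      P₀.real {ω | X ω ∈ A ∧ W ω = 1} ≤ pUp * P₀.real (X ⁻¹' A) := by
    intro A hA
    have hint : IntegrableOn (P₀[W | MeasurableSpace.comap X inferInstance]) (X ⁻¹' A) P₀ :=
      integrable_condExp.integrableOn
    rw [← hpop.setIntegral_W A, ← setIntegral_condExp hpop.measurable_X.comap_le
      hpop.integrable_W ⟨A, hA, rfl⟩]
    constructor
    · have := setIntegral_mono_ae (integrable_const pLow).integrableOn hint
        (hb.mono fun ω h => h.1)
      simpa [mul_comm] using this
    · have := setIntegral_mono_ae hint (integrable_const pUp).integrableOn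
        (hb.mono fun ω h => h.2)
      simpa [mul_comm] using this
  -- `pLow` serves the treated and `1 - pUp` the untreated.
  refine ⟨min pLow (1 - pUp), lt_min hLow (by linarith), fun c hc A hA => ?_⟩
  have hν : 0 ≤ P₀.real (X ⁻¹' A) := measureReal_nonneg
  obtain ⟨h₁, h₂⟩ := hone A hA
  rcases hc with rfl | rfl
  · have hsum : P₀.real (X ⁻¹' A) ≤
        P₀.real {ω | X ω ∈ A ∧ W ω = 0} + P₀.real {ω | X ω ∈ A ∧ W ω = 1} := by
      refine le_trans (ENNReal.toReal_mono (measure_ne_top _ _) (measure_mono_ae ?_))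
        (measureReal_union_le _ _)
      filter_upwards [hpop.binary] with ω h hω
      exact h.imp (fun h => ⟨hω, h⟩) fun h => ⟨hω, h⟩
    nlinarith [mul_le_mul_of_nonneg_right (min_le_right pLow (1 - pUp)) hν]
  · exact (mul_le_mul_of_nonneg_right (min_le_left _ _) hν).trans h₁

/-- Makes the mass of a boundary strip comparable to its length. -/
lemma exists_density_bound [IsFiniteMeasure P₀]
    (hpop : IsPopulation P₀ Y1 Y0 W X xL xU)
    (hsmooth : MonotoneSmooth P₀ X p xL xU) :
    ∃ fLow fUp : ℝ, 0 < fLow ∧ 0 < fUp ∧ ∀ A : Set ℝ, MeasurableSet A →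
      fLow * volume.real (A ∩ Set.Icc xL xU) ≤ P₀.real (X ⁻¹' A) ∧
      P₀.real (X ⁻¹' A) ≤ fUp * volume.real (A ∩ Set.Icc xL xU) := by
  obtain ⟨f, -, ⟨fLow, fUp, hLow, hUp, hf⟩, hmap⟩ := hsmooth.density
  refine ⟨fLow, fUp, hLow, hUp, fun A hA => ?_⟩
  have hfin : volume (A ∩ Set.Icc xL xU) ≠ ⊤ :=
    measure_ne_top_of_subset Set.inter_subset_right (by simp)
  have hmeas : MeasurableSet (A ∩ Set.Icc xL xU) := hA.inter measurableSet_Icc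
  have hA' : P₀ (X ⁻¹' A) = ∫⁻ x in A ∩ Set.Icc xL xU, ENNReal.ofReal (f x) := by
    rw [← Measure.map_apply hpop.measurable_X hA, hmap, withDensity_apply _ hA,
      Measure.restrict_restrict hA]
  have hlow : ENNReal.ofReal fLow * volume (A ∩ Set.Icc xL xU) ≤ P₀ (X ⁻¹' A) := by
    rw [hA', ← setLIntegral_const]
    exact setLIntegral_mono' hmeas fun x hx => ENNReal.ofReal_le_ofReal (hf x hx.2).1.le
  have hup : P₀ (X ⁻¹' A) ≤ ENNReal.ofReal fUp * volume (A ∩ Set.Icc xL xU) := by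
    rw [hA', ← setLIntegral_const]
    exact setLIntegral_mono' hmeas fun x hx => ENNReal.ofReal_le_ofReal (hf x hx.2).2.le
  constructor
  · have := ENNReal.toReal_mono (measure_ne_top _ _) hlow
    rwa [ENNReal.toReal_mul, ENNReal.toReal_ofReal hLow.le] at this
  · have := ENNReal.toReal_mono (ENNReal.mul_ne_top ENNReal.ofReal_ne_top hfin) hup
    rwa [ENNReal.toReal_mul, ENNReal.toReal_ofReal hUp.le] at this

end Population

/-! ### Probability bounds for the sample. -/

namespace IsIIDSample

variable {Ω₀ : Type*} [MeasurableSpace Ω₀] {P₀ : Measure Ω₀}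
  {Y W X : Ω₀ → ℝ} {Ω : Type*} [MeasurableSpace Ω] {P : Measure Ω}
  {N : ℕ} {Ys Ws Xs : Fin N → Ω → ℝ}

lemma measure_mem_eq (hs : IsIIDSample P Ys Ws Xs P₀ Y W X) (i : Fin N) {B : Set (ℝ × ℝ)}
    (hB : MeasurableSet B) :
    P {ω | (Ws i ω, Xs i ω) ∈ B} = P₀ {ω | (W ω, X ω) ∈ B} :=
  (hs.identDistrib i).measure_mem_eq (s := Prod.snd ⁻¹' B) (measurable_snd hB)

lemma aemeasurable_X (hs : IsIIDSample P Ys Ws Xs P₀ Y W X) (i : Fin N) :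
    AEMeasurable (Xs i) P :=
  (measurable_snd.comp measurable_snd).comp_aemeasurable (hs.identDistrib i).aemeasurable_fst

lemma ae_binary (hs : IsIIDSample P Ys Ws Xs P₀ Y W X) (hW : ∀ᵐ ω ∂P₀, W ω = 0 ∨ W ω = 1) :
    ∀ᵐ ω ∂P, ∀ i, Ws i ω = 0 ∨ Ws i ω = 1 := by
  refine ae_all_iff.2 fun i => ?_
  have hB : MeasurableSet {q : ℝ × ℝ | ¬ (q.1 = 0 ∨ q.1 = 1)} := by
    refine MeasurableSet.compl (MeasurableSet.union ?_ ?_)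
    · exact measurable_fst (measurableSet_singleton 0)
    · exact measurable_fst (measurableSet_singleton 1)
  exact (hs.measure_mem_eq i hB).trans hW

/-- A sample from a continuous distribution has no ties. -/
lemma ae_injective [IsFiniteMeasure P]
    (hs : IsIIDSample P Ys Ws Xs P₀ Y W X) (hX : ∀ x, P₀ {ω | X ω = x} = 0) :
    ∀ᵐ ω ∂P, Function.Injective fun i => Xs i ω := by
  have hne : ∀ i j, i ≠ j → ∀ᵐ ω ∂P, Xs i ω ≠ Xs j ω := by
    intro i j hij
    have hindep : IndepFun (Xs i) (Xs j) P :=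
      (hs.indep.indepFun hij).comp (measurable_snd.comp measurable_snd)
        (measurable_snd.comp measurable_snd)
    have hprod := (indepFun_iff_map_prod_eq_prod_map_map (hs.aemeasurable_X i)
      (hs.aemeasurable_X j)).1 hindep
    have hD : MeasurableSet {q : ℝ × ℝ | q.1 = q.2} :=
      measurableSet_eq_fun measurable_fst measurable_snd
    have hnull : (P.map fun ω => (Xs i ω, Xs j ω)) {q : ℝ × ℝ | q.1 = q.2} = 0 := by
      rw [hprod, Measure.measure_prod_null hD]
      refine Eventually.of_forall fun x => ?_
      change (P.map (Xs j)) (Prod.mk x ⁻¹' {q : ℝ × ℝ | q.1 = q.2}) = 0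
      rw [Measure.map_apply_of_aemeasurable (hs.aemeasurable_X j) (measurable_prodMk_left hD)]
      have := hs.measure_mem_eq j (B := {q | q.2 = x}) (measurable_snd (measurableSet_singleton x))
      simp only [Set.mem_ofPred_eq, hX] at this
      simpa [Set.preimage, eq_comm] using this
    rw [Measure.map_apply_of_aemeasurable ((hs.aemeasurable_X i).prodMk (hs.aemeasurable_X j)) hD]
      at hnull
    simpa [ae_iff] using hnull
  have hall : ∀ᵐ ω ∂P, ∀ i j, i ≠ j → Xs i ω ≠ Xs j ω :=
    ae_all_iff.2 fun i => ae_all_iff.2 fun j => by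
      by_cases h : i = j
      · simp [h]
      · simpa [h] using hne i j h
  filter_upwards [hall] with ω h i j hij
  by_contra hne
  exact h i j hne hij

/-- By independence the probability is `(1 - q) ^ N`, and `1 - q ≤ exp (-q)`. -/
lemma measureReal_forall_not_le [IsProbabilityMeasure P₀]
    (hs : IsIIDSample P Ys Ws Xs P₀ Y W X) (hW : Measurable W)
    (hX : Measurable X) {A : Set ℝ} (hA : MeasurableSet A) (c : ℝ) :
    P.real {ω | ∀ i, ¬ (Xs i ω ∈ A ∧ Ws i ω = c)}
      ≤ Real.exp (-(N * P₀.real {ω | X ω ∈ A ∧ W ω = c})) := by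
  have hB : MeasurableSet {q : ℝ × ℝ | ¬ (q.2 ∈ A ∧ q.1 = c)} :=
    ((measurable_snd hA).inter (measurable_fst (measurableSet_singleton c))).compl
  have hE : MeasurableSet {ω | X ω ∈ A ∧ W ω = c} :=
    (hX hA).inter (hW (measurableSet_singleton c))
  have hind := hs.indep.measure_inter_preimage_eq_mul Finset.univ
    (sets := fun _ => Prod.snd ⁻¹' {q : ℝ × ℝ | ¬ (q.2 ∈ A ∧ q.1 = c)})
    (fun i _ => measurable_snd hB)
  have hset : {ω | ∀ i, ¬ (Xs i ω ∈ A ∧ Ws i ω = c)} = ⋂ i ∈ Finset.univ,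
      (fun ω => (Ys i ω, Ws i ω, Xs i ω)) ⁻¹'
        (Prod.snd ⁻¹' {q : ℝ × ℝ | ¬ (q.2 ∈ A ∧ q.1 = c)}) := by
    ext ω
    simp
  have hprob : ∀ i, P ((fun ω => (Ys i ω, Ws i ω, Xs i ω)) ⁻¹'
        (Prod.snd ⁻¹' {q : ℝ × ℝ | ¬ (q.2 ∈ A ∧ q.1 = c)})) = P₀ {ω | X ω ∈ A ∧ W ω = c}ᶜ :=
    fun i => hs.measure_mem_eq i hB
  rw [measureReal_def, hset, hind, Finset.prod_congr rfl fun i _ => hprob i, Finset.prod_const,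
    Finset.card_univ, Fintype.card_fin, ENNReal.toReal_pow, ← measureReal_def,
    probReal_compl_eq_one_sub hE, neg_mul_eq_mul_neg, Real.exp_nat_mul]
  exact pow_le_pow_left₀ (sub_nonneg.2 measureReal_le_one) (Real.one_sub_le_exp_neg _) N

/-- Markov's inequality for the count at level `m + 1`. The sample is only a.e. measurable, hence
the null-measurable sets. -/
lemma measureReal_lt_card_le [IsFiniteMeasure P₀]
    (hs : IsIIDSample P Ys Ws Xs P₀ Y W X) {A : Set ℝ}
    [DecidablePred (· ∈ A)] (hA : MeasurableSet A) (m : ℕ) :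
    P.real {ω | m < (Finset.univ.filter fun i => Xs i ω ∈ A).card}
      ≤ N * P₀.real (X ⁻¹' A) / (m + 1) := by
  have hmeas : ∀ i, NullMeasurableSet (Xs i ⁻¹' A) P := fun i =>
    (hs.aemeasurable_X i).nullMeasurableSet_preimage hA
  have hf : ∀ i, AEMeasurable ((Xs i ⁻¹' A).indicator (1 : Ω → ENNReal)) P := fun i =>
    aemeasurable_one.indicator₀ (hmeas i)
  have hmarkov := mul_meas_ge_le_lintegral₀ (μ := P)
    (Finset.aemeasurable_fun_sum Finset.univ fun i _ => hf i) ((m + 1 : ℕ) : ENNReal)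
  rw [lintegral_finsetSum' _ fun i _ => hf i] at hmarkov
  have hprob : ∀ i, ∫⁻ ω, (Xs i ⁻¹' A).indicator (1 : Ω → ENNReal) ω ∂P = P₀ (X ⁻¹' A) := by
    intro i
    rw [lintegral_indicator_one₀ (hmeas i)]
    exact hs.measure_mem_eq i (B := Prod.snd ⁻¹' A) (measurable_snd hA)
  have hset : {ω | ((m + 1 : ℕ) : ENNReal)
        ≤ ∑ i, (Xs i ⁻¹' A).indicator (1 : Ω → ENNReal) ω}
      = {ω | m < (Finset.univ.filter fun i => Xs i ω ∈ A).card} := by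
    ext ω
    have : ∑ i, (Xs i ⁻¹' A).indicator (1 : Ω → ENNReal) ω
        = ((Finset.univ.filter fun i => Xs i ω ∈ A).card : ENNReal) := by
      rw [Finset.card_filter]
      push_cast
      exact Finset.sum_congr rfl fun i _ => by simp [Set.indicator]
    rw [Set.mem_ofPred_eq, this, Nat.cast_le, Set.mem_ofPred_eq, Nat.succ_le_iff]
  rw [hset, Finset.sum_congr rfl fun i _ => hprob i, Finset.sum_const, Finset.card_univ,
    Fintype.card_fin, nsmul_eq_mul] at hmarkov
  have := ENNReal.toReal_mono (ENNReal.mul_ne_top (by simp) (measure_ne_top _ _)) hmarkov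
  rw [ENNReal.toReal_mul, ENNReal.toReal_mul, ENNReal.toReal_natCast, ENNReal.toReal_natCast] at this
  rw [le_div_iff₀ (by positivity), mul_comm]
  exact_mod_cast this

end IsIIDSample

/-! ### Union bound over the bad events. -/

section Bound

variable {Ω₀ : Type*} [MeasurableSpace Ω₀] {P₀ : Measure Ω₀} [IsProbabilityMeasure P₀]
  {Y1 Y0 W X : Ω₀ → ℝ} {xL xU : ℝ}

/-- Six bad events: an overfull strip at either end, or a treatment missing from a strip. Adding the
errors to the probability, instead of bounding a complement, needs only subadditivity and no
measurability of the matching event. -/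
lemma one_le_measureReal_add (hpop : IsPopulation P₀ Y1 Y0 W X xL xU)
    {Ω : Type*} [MeasurableSpace Ω] {P : Measure Ω} [IsProbabilityMeasure P] {N : ℕ}
    {Ys Ws Xs : Fin N → Ω → ℝ}
    (hs : IsIIDSample P Ys Ws Xs P₀ (outcome Y1 Y0 W) W X) (hN : 2 * blockSize N ≤ N)
    {a b u r : ℝ} (hua : P₀.real (X ⁻¹' Set.Iic a) ≤ u) (hub : P₀.real (X ⁻¹' Set.Ici b) ≤ u)
    (hra : ∀ c : ℝ, c = 0 ∨ c = 1 → r ≤ P₀.real {ω | X ω ∈ Set.Iic a ∧ W ω = c})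
    (hrb : ∀ c : ℝ, c = 0 ∨ c = 1 → r ≤ P₀.real {ω | X ω ∈ Set.Ici b ∧ W ω = c}) :
    1 ≤ P.real {ω | ∀ i : Fin N, (matchedSet
          (ordered (fun j => Xs j ω) (fun j => Ws j ω))
          (ordered (fun j => Xs j ω) (fun j => Xs j ω)) i).Nonempty}
        + (2 * (N * u / (blockSize N + 1)) + 4 * Real.exp (-(N * r))) := by
  set E := {ω | ∀ i : Fin N, (matchedSet
          (ordered (fun j => Xs j ω) (fun j => Ws j ω))
          (ordered (fun j => Xs j ω) (fun j => Xs j ω)) i).Nonempty}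
  set m := blockSize N
  let C (A : Set ℝ) [DecidablePred (· ∈ A)] : Set Ω :=
    {ω | m < (Finset.univ.filter fun i => Xs i ω ∈ A).card}
  let M (A : Set ℝ) (c : ℝ) : Set Ω := {ω | ∀ i, ¬ (Xs i ω ∈ A ∧ Ws i ω = c)}
  have hC : ∀ (A : Set ℝ) [DecidablePred (· ∈ A)], MeasurableSet A → P₀.real (X ⁻¹' A) ≤ u →
      P.real (C A) ≤ N * u / (m + 1) := fun A _ hA hu =>
    (hs.measureReal_lt_card_le hA m).trans (by gcongr)
  have hM : ∀ (A : Set ℝ) (c : ℝ), MeasurableSet A → r ≤ P₀.real {ω | X ω ∈ A ∧ W ω = c} →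
      P.real (M A c) ≤ Real.exp (-(N * r)) := fun A c hA hr =>
    (hs.measureReal_forall_not_le hpop.measurable_W hpop.measurable_X hA c).trans (by gcongr)
  have hcover : ∀ᵐ ω ∂P, ω ∈ E ∪ (C (Set.Iic a) ∪ (C (Set.Ici b) ∪
      (M (Set.Iic a) 0 ∪ (M (Set.Iic a) 1 ∪ (M (Set.Ici b) 0 ∪ M (Set.Ici b) 1))))) := by
    filter_upwards [hs.ae_binary hpop.binary, hs.ae_injective hpop.continuous_law] with ω hbin hinj
    by_contra hω
    simp only [Set.mem_union, not_or, C, M, Set.mem_ofPred_eq, not_lt, not_forall, not_not] at hω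
    obtain ⟨hωE, hCa, hCb, ha0, ha1, hb0, hb1⟩ := hω
    refine hωE fun i => matchedSet_nonempty (fun j => hbin _) (strictMono_ordered hinj) hN ?_ ?_ i
    · rintro c (rfl | rfl)
      · exact exists_ordered_val_lt hCa ha0
      · exact exists_ordered_val_lt hCa ha1
    · rintro c (rfl | rfl)
      · exact exists_ordered_le_val hCb hb0
      · exact exists_ordered_le_val hCb hb1
  have hle : P.real Set.univ ≤ P.real (E ∪ (C (Set.Iic a) ∪ (C (Set.Ici b) ∪
      (M (Set.Iic a) 0 ∪ (M (Set.Iic a) 1 ∪ (M (Set.Ici b) 0 ∪ M (Set.Ici b) 1)))))) :=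
    ENNReal.toReal_mono (measure_ne_top _ _)
      (measure_mono_ae (hcover.mono fun ω h (_ : ω ∈ Set.univ) => h))
  rw [probReal_univ] at hle
  have h₁ := measureReal_union_le (μ := P) E (C (Set.Iic a) ∪ (C (Set.Ici b) ∪
      (M (Set.Iic a) 0 ∪ (M (Set.Iic a) 1 ∪ (M (Set.Ici b) 0 ∪ M (Set.Ici b) 1)))))
  have h₂ := measureReal_union_le (μ := P) (C (Set.Iic a)) (C (Set.Ici b) ∪
      (M (Set.Iic a) 0 ∪ (M (Set.Iic a) 1 ∪ (M (Set.Ici b) 0 ∪ M (Set.Ici b) 1))))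
  have h₃ := measureReal_union_le (μ := P) (C (Set.Ici b))
      (M (Set.Iic a) 0 ∪ (M (Set.Iic a) 1 ∪ (M (Set.Ici b) 0 ∪ M (Set.Ici b) 1)))
  have h₄ := measureReal_union_le (μ := P) (M (Set.Iic a) 0)
    (M (Set.Iic a) 1 ∪ (M (Set.Ici b) 0 ∪ M (Set.Ici b) 1))
  have h₅ := measureReal_union_le (μ := P) (M (Set.Iic a) 1) (M (Set.Ici b) 0 ∪ M (Set.Ici b) 1)
  have h₆ := measureReal_union_le (μ := P) (M (Set.Ici b) 0) (M (Set.Ici b) 1)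
  linarith [hC _ measurableSet_Iic hua, hC _ measurableSet_Ici hub,
    hM _ 0 measurableSet_Iic (hra 0 (.inl rfl)), hM _ 1 measurableSet_Iic (hra 1 (.inr rfl)),
    hM _ 0 measurableSet_Ici (hrb 0 (.inl rfl)), hM _ 1 measurableSet_Ici (hrb 1 (.inr rfl))]

end Bound

/-! ### Rates in `N`. -/

section Asymptotics

lemma tendsto_natCast_rpow_neg {y : ℝ} (hy : 0 < y) :
    Tendsto (fun N : ℕ => (N : ℝ) ^ (-y)) atTop (𝓝 0) :=
  (tendsto_rpow_neg_atTop hy).comp tendsto_natCast_atTop_atTop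

lemma natCast_mul_rpow_neg_two_thirds {N : ℕ} (hN : 0 < N) :
    (N : ℝ) * (N : ℝ) ^ (-(2 / 3) : ℝ) = (N : ℝ) ^ (1 / 3 : ℝ) := by
  have hN' : (0 : ℝ) < N := by exact_mod_cast hN
  conv_lhs => rw [← Real.rpow_one_add' hN'.le (by norm_num)]
  norm_num

lemma eventually_two_mul_blockSize_le : ∀ᶠ N : ℕ in atTop, 2 * blockSize N ≤ N := by
  filter_upwards [(tendsto_natCast_rpow_neg (y := 1 / 3) (by norm_num)).eventually_le_const
    (show (0 : ℝ) < 1 / 2 by norm_num), eventually_gt_atTop 0] with N hN hpos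
  have hN' : (0 : ℝ) < N := by exact_mod_cast hpos
  have h₁ : (blockSize N : ℝ) ≤ (N : ℝ) ^ (2 / 3 : ℝ) := Nat.floor_le (by positivity)
  have h₂ : (N : ℝ) ^ (2 / 3 : ℝ) = N * (N : ℝ) ^ (-(1 / 3) : ℝ) := by
    rw [← Real.rpow_one_add' hN'.le (by norm_num)]
    norm_num
  have h₃ : (2 * blockSize N : ℝ) ≤ N := by nlinarith
  exact_mod_cast h₃

/-- The `+ 1` from Markov's inequality absorbs the floor in `blockSize`. -/
lemma div_blockSize_le {N : ℕ} (hN : 0 < N) {f : ℝ} (hf : 0 < f) :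
    N * (f * (N : ℝ) ^ (-(2 / 3) : ℝ)) / (blockSize N + 1) ≤ f * (N : ℝ) ^ (-(1 / 3) : ℝ) := by
  have hN' : (0 : ℝ) < N := by exact_mod_cast hN
  have hlt : (N : ℝ) ^ (2 / 3 : ℝ) ≤ blockSize N + 1 := (Nat.lt_floor_add_one _).le
  have h₁ : (N : ℝ) ^ (1 / 3 : ℝ) = (N : ℝ) ^ (-(1 / 3) : ℝ) * (N : ℝ) ^ (2 / 3 : ℝ) := by
    rw [← Real.rpow_add hN']
    norm_num
  rw [div_le_iff₀ (by positivity), mul_left_comm, natCast_mul_rpow_neg_two_thirds hN, h₁, mul_assoc]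
  gcongr

end Asymptotics

end UCIso

theorem mainTheorem8
    {Ω₀ : Type*} [MeasurableSpace Ω₀] (P₀ : Measure Ω₀) [IsProbabilityMeasure P₀]
    (Y1 Y0 W X : Ω₀ → ℝ) (xL xU : ℝ) (hx : xL < xU) (p : ℝ → ℝ)
    (hpop : UCIso.IsPopulation P₀ Y1 Y0 W X xL xU)
    (hp : UCIso.IsPropensityScore P₀ W X p)
    (hsmooth : UCIso.MonotoneSmooth P₀ X p xL xU)
    (hoverlap : UCIso.StrictOverlap p xL xU)
    {Ω : ℕ → Type*} [∀ N, MeasurableSpace (Ω N)] (P : ∀ N, Measure (Ω N))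
    [∀ N, IsProbabilityMeasure (P N)]
    (Ys Ws Xs : ∀ N, Fin N → Ω N → ℝ)
    (hsample : ∀ N, UCIso.IsIIDSample (P N) (Ys N) (Ws N) (Xs N)
      P₀ (UCIso.outcome Y1 Y0 W) W X) :
    Tendsto (fun N => P N {ω | ∀ i : Fin N,
      (UCIso.matchedSet
        (UCIso.ordered (fun j => Xs N j ω) (fun j => Ws N j ω))
        (UCIso.ordered (fun j => Xs N j ω) (fun j => Xs N j ω)) i).Nonempty})
      atTop (𝓝 1) := by
  obtain ⟨δ, hδ, hδb⟩ := UCIso.exists_overlap_bound hpop hp hoverlap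
  obtain ⟨fLow, fUp, hLow, hUp, hf⟩ := UCIso.exists_density_bound hpop hsmooth
  rw [← ENNReal.tendsto_toReal_iff (fun N => measure_ne_top _ _) ENNReal.one_ne_top,
    ENNReal.toReal_one]
  have hlim : Tendsto (fun N : ℕ => 1 - (2 * (fUp * (N : ℝ) ^ (-(1 / 3) : ℝ))
      + 4 * Real.exp (-(δ * fLow * (N : ℝ) ^ (1 / 3 : ℝ))))) atTop (𝓝 1) := by
    have h₁ := (UCIso.tendsto_natCast_rpow_neg (y := 1 / 3) (by norm_num)).const_mul fUp
    have h₂ : Tendsto (fun N : ℕ => δ * fLow * (N : ℝ) ^ (1 / 3 : ℝ)) atTop atTop :=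
      ((tendsto_rpow_atTop (by norm_num)).comp tendsto_natCast_atTop_atTop).const_mul_atTop
        (by positivity)
    simpa using ((h₁.const_mul 2).add
      ((Real.tendsto_exp_neg_atTop_nhds_zero.comp h₂).const_mul 4)).const_sub 1
  refine tendsto_of_tendsto_of_tendsto_of_le_of_le' hlim tendsto_const_nhds ?_
    (Eventually.of_forall fun N => measureReal_le_one)
  filter_upwards [eventually_gt_atTop 0, UCIso.eventually_two_mul_blockSize_le,
    (UCIso.tendsto_natCast_rpow_neg (y := 2 / 3) (by norm_num)).eventually_le_const
      (sub_pos.2 hx)] with N hN hblock hh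
  -- Strip width: `N * h = N ^ (1/3)` diverges but is of smaller order than the block size. By `hh`
  -- the strips stay inside the support and have full length `h`.
  set h : ℝ := (N : ℝ) ^ (-(2 / 3) : ℝ) with hdef
  have hh0 : 0 ≤ h := by positivity
  have hva : volume.real (Set.Iic (xL + h) ∩ Set.Icc xL xU) = h := by
    rw [show Set.Iic (xL + h) ∩ Set.Icc xL xU = Set.Icc xL (xL + h) by
      ext x; simp only [Set.mem_inter_iff, Set.mem_Iic, Set.mem_Icc]
      constructor
      · rintro ⟨h₁, h₂, -⟩; exact ⟨h₂, h₁⟩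
      · rintro ⟨h₁, h₂⟩; exact ⟨h₂, h₁, by linarith⟩,
      Real.volume_real_Icc_of_le (by linarith)]
    ring
  have hvb : volume.real (Set.Ici (xU - h) ∩ Set.Icc xL xU) = h := by
    rw [show Set.Ici (xU - h) ∩ Set.Icc xL xU = Set.Icc (xU - h) xU by
      ext x; simp only [Set.mem_inter_iff, Set.mem_Ici, Set.mem_Icc]
      constructor
      · rintro ⟨h₁, -, h₂⟩; exact ⟨h₁, h₂⟩
      · rintro ⟨h₁, h₂⟩; exact ⟨h₁, by linarith, h₂⟩,
      Real.volume_real_Icc_of_le (by linarith)]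
    ring
  have ha := hf _ (measurableSet_Iic (a := xL + h))
  have hb := hf _ (measurableSet_Ici (a := xU - h))
  rw [hva] at ha
  rw [hvb] at hb
  have hbound := UCIso.one_le_measureReal_add hpop (hsample N) hblock ha.2 hb.2
    (r := δ * (fLow * h))
    (fun c hc => (mul_le_mul_of_nonneg_left ha.1 hδ.le).trans (hδb c hc _ measurableSet_Iic))
    (fun c hc => (mul_le_mul_of_nonneg_left hb.1 hδ.le).trans (hδb c hc _ measurableSet_Ici))
  have hdiv := UCIso.div_blockSize_le hN hUp
  have hexp : (N : ℝ) * (δ * (fLow * h)) = δ * fLow * (N : ℝ) ^ (1 / 3 : ℝ) := by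
    rw [← UCIso.natCast_mul_rpow_neg_two_thirds hN]
    ring
  rw [hexp] at hbound
  rw [measureReal_def] at hbound
  linarith
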